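/- Let $d\ge 3$, let $\Delta$ be a $(d-1)$-dimensional simplex in a real vector space, and let $\Gamma$ be a (finite) geometric triangulation of $\Delta$. For a face $F\le\Delta$ (including $F=\varnothing$ and $F=\Delta$), let $\Gamma_F$ be the restriction of $\Gamma$ to $F$, and let $$h(\Gamma_F;x)=\sum_{k=0}^{\dim F+1} f_{k-1}(\Gamma_F)\,x^{k}(1-x)^{\dim F+1-k},$$ where $f_i(\Gamma_F)$ is the number of $i$-dimensional faces of $\Gamma_F$ and $f_{-1}=1$. Let $$\ell(\Gamma;x)=\sum_{i}\ell_i x^i=\sum_{F\le\Delta}(-1)^{d-1-\dim F}\,h(\Gamma_F;x)$$ be the local $h$-polynomial of $\Gamma$. A face of $\Gamma$ is said to be carried by the smallest face of $\Delta$ that contains it. The internal edge graph $\Sigma$ of $\Gamma$ is the graph whose edges are the edges of $\Gamma$ carried by $\Delta$ itself, and whose vertices are the vertices incident to those edges. For a connected component $C$ of $\Sigma$, let $f_i^j(C)$ be the number of $i$-dimensional faces of $C$ (vertices for $i=0$, edges for $i=1$) that are carried by $j$-dimensional faces of $\Delta$. Suppose that $\ell_1=0$. Then every connected component $C$ of $\Sigma$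 satisfies $$f_0^{d-2}(C)\le f_1^{d-1}(C).$$ Moreover $$\ell_2=\sum_{C}\bigl(f_1^{d-1}(C)-f_0^{d-2}(C)\bigr),$$ the sum being over the connected components $C$ of $\Sigma$, and consequently $\ell_2\ge 0$. -/

import Mathlib

open Polynomial

/-- A (geometric) triangulation of the simplex `Δ` with vertices `p 0, …, p (d - 1)`: a finite
geometric simplicial complex whose underlying space is `Δ`. The `faces` of the complex are the
vertex sets of its nonempty faces. -/
structure SimplexTriangulation {E : Type*} [AddCommGroup E] [Module ℝ E] {d : ℕ} (p : Fin d → E)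
    extends Geometry.SimplicialComplex ℝ E where
  finite_faces : faces.Finite
  space_eq : toSimplicialComplex.space = convexHull ℝ (Set.range p)

/-- The number `f_{k-1}` of faces with `k` vertices; the empty face counts, so `f_{-1} = 1`. -/
noncomputable def faceNumber {E : Type*} [AddCommGroup E] [Module ℝ E]
    (K : Geometry.SimplicialComplex ℝ E) (k : ℕ) : ℕ :=
  if k = 0 then 1 else {G : Finset E | G ∈ K.faces ∧ G.card = k}.ncard

/-- The `h`-polynomial `∑_{k ≤ n} f_{k-1} x^k (1 - x)^{n-k}` of a complex that triangulates a
simplex with `n` vertices. -/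
noncomputable def hPolynomial {E : Type*} [AddCommGroup E] [Module ℝ E]
    (K : Geometry.SimplicialComplex ℝ E) (n : ℕ) : ℤ[X] :=
  ∑ k ∈ Finset.range (n + 1), (faceNumber K k : ℤ[X]) * X ^ k * (1 - X) ^ (n - k)

namespace SimplexTriangulation

variable {E : Type*} [AddCommGroup E] [Module ℝ E] {d : ℕ} {p : Fin d → E}

/-- The restriction `Γ_F` of the triangulation to the face of `Δ` with vertices `p i`, `i ∈ F`. -/
def restrict (Γ : SimplexTriangulation p) (F : Finset (Fin d)) :
    Geometry.SimplicialComplex ℝ E where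
  faces := {G | G ∈ Γ.faces ∧ (G : Set E) ⊆ convexHull ℝ (p '' (F : Set (Fin d)))}
  isRelLowerSet_faces := by
    intro G hG
    refine ⟨(Γ.isRelLowerSet_faces hG.1).1, fun H hHG hH => ⟨Γ.down_closed hG.1 hHG hH, ?_⟩⟩
    exact (Finset.coe_subset.2 hHG).trans hG.2
  indep := fun hG => Γ.indep hG.1
  inter_subset_convexHull := fun hG hH => Γ.inter_subset_convexHull hG.1 hH.1

/-- The local `h`-polynomial `ℓ(Γ; x) = ∑_{F ≤ Δ} (-1)^{codim F} h(Γ_F; x)`, the sum being over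
all faces of `Δ`, including the empty one and `Δ` itself. -/
noncomputable def localH (Γ : SimplexTriangulation p) : ℤ[X] :=
  ∑ F : Finset (Fin d), (-1) ^ (d - F.card) * hPolynomial (Γ.restrict F) F.card

/-- The (vertex set of the) smallest face of `Δ` that contains all the points of `G`. It is the
face carrying `G` when `G` is a face of a triangulation of `Δ`. -/
def carrier (_Γ : SimplexTriangulation p) (G : Finset E) : Set (Fin d) :=
  ⋂ F ∈ {F : Set (Fin d) | (G : Set E) ⊆ convexHull ℝ (p '' F)}, F

/-- The edges of the triangulation that are carried by `Δ` itself. -/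
def internalEdges (Γ : SimplexTriangulation p) : Set (Finset E) :=
  {e | e ∈ Γ.faces ∧ e.card = 2 ∧ Γ.carrier e = Set.univ}

/-- The vertices incident to an edge carried by `Δ`. -/
def internalVertices (Γ : SimplexTriangulation p) : Set E :=
  {v | ∃ e ∈ Γ.internalEdges, v ∈ e}

/-- The internal edge graph `Σ(Γ)`. -/
def internalEdgeGraph (Γ : SimplexTriangulation p) : SimpleGraph Γ.internalVertices where
  Adj u v := u ≠ v ∧ ∃ e ∈ Γ.internalEdges, (e : Set E) = {(u : E), (v : E)}
  symm := ⟨fun u v h => ⟨h.1.symm, by simpa only [Set.pair_comm] using h.2⟩⟩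
  loopless := ⟨fun _ h => h.1 rfl⟩

/-- The faces of a connected component `C` of the internal edge graph, seen as a
one-dimensional subcomplex of the triangulation: its vertices and its edges. -/
def componentFaces (Γ : SimplexTriangulation p) (C : Γ.internalEdgeGraph.ConnectedComponent) :
    Set (Finset E) :=
  {G | (∃ v ∈ C.supp, G = {(v : E)}) ∨
    (∃ u ∈ C.supp, ∃ v ∈ C.supp, Γ.internalEdgeGraph.Adj u v ∧
      (G : Set E) = {(u : E), (v : E)})}

/-- `Γ.componentFaceNumber C i j` is `f_i^j(C)`, the number of `i`-dimensional faces of `C` that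
are carried by `j`-dimensional faces of `Δ`. -/
noncomputable def componentFaceNumber (Γ : SimplexTriangulation p)
    (C : Γ.internalEdgeGraph.ConnectedComponent) (i j : ℕ) : ℕ :=
  {G | G ∈ Γ.componentFaces C ∧ G.card = i + 1 ∧ (Γ.carrier G).ncard = j + 1}.ncard

end SimplexTriangulation

/-! ### Barycentric coordinates as affine functions on the ambient space. -/

section BarycentricCoordinates

variable {E : Type*} [AddCommGroup E] [Module ℝ E] {d : ℕ} {p : Fin d → E}

/-! Exchanging sums in `localH`, a face `G` whose carrier has `c` vertices contributes `(-1)^(d-c)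
x^(d-c+|G|) (1-x)^(c-|G|)` (`localH_eq_sum`). As `d ≥ 3`, `ℓ_1` counts the vertices carried by `Δ`;
if there are none, `ℓ_2` is the number of internal edges minus the number of vertices carried by
facets of `Δ`. Every such vertex lies on an internal edge, so both counts split over the components
of the internal edge graph.

For the inequality, a connected component has at least as many edges as vertices minus one. If it
failed, the component would be a tree with all its vertices carried by facets. Take an internal edge
`ab` of it, with `a` carried by facet `i` and `b` by facet `j`. In any face containing component
vertices of both types, a vertex off facet `i` is joined to the one of type `i`; having no triangle
forces it to be of type `j`, and symmetrically. Hence containing both types passes from one face to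
any other that meets it at an interior point of `Δ`. Connectedness of the interior spreads it to a
face that contains the vertex `p i` and meets the interior. This is absurd: at `p i` all coordinates
but the `i`-th vanish, while a vertex of type `j` has only one zero coordinate and `d ≥ 3`
(`not_triangleFree`). -/

theorem AffineIndependent.exists_dual_affineMap (hp : AffineIndependent ℝ p) :
    ∃ lam : Fin d → E →ᵃ[ℝ] ℝ, ∀ i j, lam i (p j) = if i = j then 1 else 0 := by
  classical
  -- Completing `p` to an affine basis of the whole space makes the coordinates globally defined.
  obtain ⟨t, ht, hi, hs⟩ := exists_subset_affineIndependent_affineSpan_eq_top hp.range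
  let b : AffineBasis t ℝ E := ⟨fun x => x, hi, by simpa using hs⟩
  refine ⟨fun i => b.coord ⟨p i, ht ⟨i, rfl⟩⟩, fun i j => ?_⟩
  have h := b.coord_apply ⟨p i, ht ⟨i, rfl⟩⟩ ⟨p j, ht ⟨j, rfl⟩⟩
  have hb : b ⟨p j, ht ⟨j, rfl⟩⟩ = p j := rfl
  rw [hb] at h
  rw [h]
  simp [hp.injective.eq_iff]

/-- Affine functions on the ambient space that restrict to the barycentric coordinates of the
simplex with vertices `p i`. -/
noncomputable def AffineIndependent.baryCoord (hp : AffineIndependent ℝ p) :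
    Fin d → E →ᵃ[ℝ] ℝ :=
  hp.exists_dual_affineMap.choose

variable (hp : AffineIndependent ℝ p)

theorem AffineIndependent.baryCoord_apply (i j : Fin d) :
    hp.baryCoord i (p j) = if i = j then 1 else 0 :=
  hp.exists_dual_affineMap.choose_spec i j

theorem AffineMap.map_sum_smul {ι : Type*} {s : Finset ι} (f : E →ᵃ[ℝ] ℝ) {w : ι → ℝ}
    (hw : ∑ i ∈ s, w i = 1) (z : ι → E) : f (∑ i ∈ s, w i • z i) = ∑ i ∈ s, w i * f (z i) := by
  rw [f.decomp]
  simp [mul_add, Finset.sum_add_distrib, ← Finset.sum_mul, hw]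

theorem AffineIndependent.exists_weights_of_mem {z : E} (hz : z ∈ convexHull ℝ (Set.range p)) :
    (∀ i, 0 ≤ hp.baryCoord i z) ∧ ∑ i, hp.baryCoord i z = 1 ∧
      z = ∑ i, hp.baryCoord i z • p i := by
  rw [convexHull_range_eq_exists_affineCombination] at hz
  obtain ⟨s, w, h0, h1, rfl⟩ := hz
  rw [s.affineCombination_eq_linear_combination _ _ h1]
  have key : ∀ i, hp.baryCoord i (∑ j ∈ s, w j • p j) = if i ∈ s then w i else 0 := by
    intro i
    rw [AffineMap.map_sum_smul _ h1]
    simp [hp.baryCoord_apply]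
  simp only [key]
  refine ⟨fun i => ?_, by simpa using h1, by simp⟩
  split_ifs with h
  exacts [h0 i h, le_rfl]

theorem AffineIndependent.mem_convexHull_image_iff {z : E} {F : Set (Fin d)} :
    z ∈ convexHull ℝ (p '' F) ↔
      z ∈ convexHull ℝ (Set.range p) ∧ ∀ i ∉ F, hp.baryCoord i z = 0 := by
  classical
  constructor
  · intro hz
    refine ⟨convexHull_mono (Set.image_subset_range _ _) hz, fun i hi => ?_⟩
    have hsub : convexHull ℝ (p '' F) ⊆ hp.baryCoord i ⁻¹' {0} := by
      refine convexHull_min ?_ ((convex_singleton _).affine_preimage _)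
      rintro _ ⟨j, hj, rfl⟩
      have : i ≠ j := fun h => hi (h ▸ hj)
      simp [hp.baryCoord_apply, this]
    exact hsub hz
  · rintro ⟨hz, h⟩
    obtain ⟨h0, h1, h2⟩ := hp.exists_weights_of_mem hz
    have hs : ∀ i, i ∉ Finset.univ.filter (· ∈ F) → hp.baryCoord i z = 0 := by
      intro i hi
      exact h i (by simpa using hi)
    rw [h2, ← Finset.sum_subset (Finset.subset_univ (Finset.univ.filter (· ∈ F)))
      (fun i _ hi => by rw [hs i hi, zero_smul])]
    refine (convex_convexHull ℝ _).sum_mem (fun i _ => h0 i) ?_ ?_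
    · rw [Finset.sum_subset (Finset.subset_univ _) (fun i _ hi => hs i hi), h1]
    · intro i hi
      exact subset_convexHull _ _ ⟨i, by simpa using hi, rfl⟩

end BarycentricCoordinates

/-! ### Closedness of convex hulls along lines, and extreme values of affine functions. -/

section Closed

variable {E : Type*} [AddCommGroup E] [Module ℝ E]

/-- The ambient space carries no topology, so closedness is tested on the parameter of a line. The
set is the projection, along a compact standard simplex, of a slice of the kernel of a linear map on
a finite-dimensional space. -/
theorem isClosed_preimage_convexHull_finset (G : Finset E) (x y : E) :
    IsClosed {t : ℝ | AffineMap.lineMap x y t ∈ convexHull ℝ (G : Set E)} := by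
  classical
  -- The second coordinate homogenizes the affine equation; it is set to `1` below.
  let L : (ℝ × ℝ × (G → ℝ)) →ₗ[ℝ] E :=
    { toFun := fun q => (q.1 • (y - x) + q.2.1 • x) - ∑ g : G, q.2.2 g • (g : E)
      map_add' := by
        intro a b
        simp only [Prod.fst_add, Prod.snd_add, Pi.add_apply, add_smul, Finset.sum_add_distrib]
        abel
      map_smul' := by
        intro c a
        simp only [Prod.smul_fst, Prod.smul_snd, Pi.smul_apply, smul_eq_mul, mul_smul,
          smul_sub, smul_add, Finset.smul_sum, RingHom.id_apply] }
  have hK : IsClosed ((LinearMap.ker L : Submodule ℝ _) : Set (ℝ × ℝ × (G → ℝ))) :=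
    Submodule.closed_of_finiteDimensional _
  have hpre : IsClosed {q : ℝ × stdSimplex ℝ G | L (q.1, 1, (q.2 : G → ℝ)) = 0} := by
    have hc : Continuous fun q : ℝ × stdSimplex ℝ G => (q.1, (1 : ℝ), (q.2 : G → ℝ)) := by
      fun_prop
    exact hK.preimage hc
  have : CompactSpace (stdSimplex ℝ G) := isCompact_iff_compactSpace.1 (isCompact_stdSimplex ℝ G)
  convert isClosedMap_fst_of_compactSpace _ hpre using 1
  ext t
  have hline : AffineMap.lineMap x y t = t • (y - x) + (1 : ℝ) • x := by
    simp [AffineMap.lineMap_apply]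
  constructor
  · intro ht
    obtain ⟨w, h0, h1, h2⟩ := Finset.mem_convexHull'.1 ht
    refine ⟨(t, ⟨fun g => w g, fun g => h0 g g.2, ?_⟩), ?_, rfl⟩
    · rw [← h1, ← Finset.sum_coe_sort G]
    · change (t • (y - x) + (1 : ℝ) • x) - ∑ g : G, w g • (g : E) = 0
      rw [← hline, ← h2, ← Finset.sum_coe_sort G, sub_self]
  · rintro ⟨⟨t', w, h0, h1⟩, h, rfl⟩
    replace h : (t' • (y - x) + (1 : ℝ) • x) - ∑ g : G, w g • (g : E) = 0 := h
    rw [← hline, sub_eq_zero] at h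
    change AffineMap.lineMap x y t' ∈ convexHull ℝ (G : Set E)
    rw [h]
    exact (convex_convexHull ℝ _).sum_mem (fun i _ => h0 i) h1
      (fun g _ => subset_convexHull _ _ g.2)

theorem exists_pos_of_mem_convexHull {s : Set E} {z : E} (f : E →ᵃ[ℝ] ℝ)
    (hz : z ∈ convexHull ℝ s) (c : ℝ) (hc : c < f z) : ∃ g ∈ s, c < f g := by
  by_contra! h
  have hsub : convexHull ℝ s ⊆ f ⁻¹' Set.Iic c :=
    convexHull_min (fun g hg => h g hg) ((convex_Iic c).affine_preimage f)
  exact absurd (hsub hz) (not_le.2 hc)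

theorem exists_le_of_mem_convexHull {s : Set E} {z : E} (f : E →ᵃ[ℝ] ℝ)
    (hz : z ∈ convexHull ℝ s) (c : ℝ) (hc : c ≤ f z) : ∃ g ∈ s, c ≤ f g := by
  by_contra! h
  have hsub : convexHull ℝ s ⊆ f ⁻¹' Set.Iio c :=
    convexHull_min (fun g hg => h g hg) ((convex_Iio c).affine_preimage f)
  exact absurd (hsub hz) (not_lt.2 hc)

end Closed

/-! ### Carriers as supports of barycentric coordinates; faces meeting the interior. -/

namespace SimplexTriangulation

variable {E : Type*} [AddCommGroup E] [Module ℝ E] {d : ℕ} {p : Fin d → E}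
  (hp : AffineIndependent ℝ p) (Γ : SimplexTriangulation p)

theorem convexHull_subset {G : Finset E} (hG : G ∈ Γ.faces) :
    convexHull ℝ (G : Set E) ⊆ convexHull ℝ (Set.range p) :=
  Γ.space_eq ▸ Γ.convexHull_subset_space hG

theorem mem_convexHull_range {G : Finset E} (hG : G ∈ Γ.faces) {g : E} (hg : g ∈ G) :
    g ∈ convexHull ℝ (Set.range p) :=
  Γ.convexHull_subset hG (subset_convexHull _ _ hg)

theorem exists_face_of_mem {z : E} (hz : z ∈ convexHull ℝ (Set.range p)) :
    ∃ G ∈ Γ.faces, z ∈ convexHull ℝ (G : Set E) := by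
  rw [← Γ.space_eq] at hz
  exact Geometry.SimplicialComplex.mem_space_iff.1 hz

theorem baryCoord_nonneg {G : Finset E} (hG : G ∈ Γ.faces) {g : E} (hg : g ∈ G) (i : Fin d) :
    0 ≤ hp.baryCoord i g :=
  (hp.exists_weights_of_mem (Γ.mem_convexHull_range hG hg)).1 i

theorem subset_convexHull_image_iff {G : Finset E} (hG : G ∈ Γ.faces) {F : Set (Fin d)} :
    (G : Set E) ⊆ convexHull ℝ (p '' F) ↔ ∀ i, (∃ g ∈ G, hp.baryCoord i g ≠ 0) → i ∈ F := by
  constructor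
  · rintro h i ⟨g, hg, hi⟩
    by_contra hF
    exact hi ((hp.mem_convexHull_image_iff.1 (h hg)).2 i hF)
  · intro h g hg
    refine hp.mem_convexHull_image_iff.2 ⟨Γ.mem_convexHull_range hG hg, fun i hi => ?_⟩
    by_contra h0
    exact hi (h i ⟨g, hg, h0⟩)

theorem mem_carrier_iff {G : Finset E} (hG : G ∈ Γ.faces) {i : Fin d} :
    i ∈ Γ.carrier G ↔ ∃ g ∈ G, hp.baryCoord i g ≠ 0 := by
  simp only [carrier, Set.mem_iInter, Set.mem_ofPred_eq, Γ.subset_convexHull_image_iff hp hG]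
  exact ⟨fun h => h {i | ∃ g ∈ G, hp.baryCoord i g ≠ 0} fun _ hj => hj, fun h F hF => hF i h⟩

theorem carrier_empty : Γ.carrier ∅ = ∅ := by
  refine Set.eq_empty_of_subset_empty fun i hi => ?_
  simp only [carrier, Set.mem_iInter, Set.mem_ofPred_eq] at hi
  exact hi ∅ (by simp)

include hp in
theorem subset_convexHull_image_iff_carrier {G : Finset E} (hG : G ∈ Γ.faces)
    {F : Set (Fin d)} : (G : Set E) ⊆ convexHull ℝ (p '' F) ↔ Γ.carrier G ⊆ F := by
  rw [Γ.subset_convexHull_image_iff hp hG]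
  exact forall_congr' fun i => by rw [Γ.mem_carrier_iff hp hG]

include hp in
-- The vertices of `G` are affinely independent and lie in the affine span of the vertices of the
-- carrier.
theorem card_le_ncard_carrier {G : Finset E} (hG : G ∈ Γ.faces) :
    G.card ≤ (Γ.carrier G).ncard := by
  classical
  have h := (Γ.subset_convexHull_image_iff_carrier hp hG).2 subset_rfl
  have hfin : (Γ.carrier G).Finite := Set.toFinite _
  have h2 : G.card ≤ (hfin.toFinset.image p).card := by
    refine (Γ.indep hG).card_le_card_of_subset_affineSpan (h.trans ?_)
    simpa using convexHull_subset_affineSpan _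
  rw [Set.ncard_eq_toFinset_card _ hfin]
  exact h2.trans Finset.card_image_le

include hp in
/-- Every point of the simplex lies in a face of the triangulation carried by the simplex. -/
theorem exists_face_carrier_eq_univ {z : E} (hd : 0 < d)
    (hz : z ∈ convexHull ℝ (Set.range p)) :
    ∃ G ∈ Γ.faces, z ∈ convexHull ℝ (G : Set E) ∧
      ∃ y ∈ convexHull ℝ (G : Set E), ∀ i, 0 < hp.baryCoord i y := by
  classical
  have hd' : (0 : ℝ) < d := by exact_mod_cast hd
  have hb1 : ∑ _i : Fin d, (1 / d : ℝ) = 1 := by simp [hd'.ne']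
  set b : E := ∑ i, (1 / d : ℝ) • p i with hb
  have hbmem : b ∈ convexHull ℝ (Set.range p) :=
    (convex_convexHull ℝ _).sum_mem (fun i _ => by positivity) hb1
      (fun i _ => subset_convexHull _ _ ⟨i, rfl⟩)
  have hbpos : ∀ i, 0 < hp.baryCoord i b := by
    intro i
    rw [hb, AffineMap.map_sum_smul _ hb1]
    simpa [hp.baryCoord_apply] using hd
  -- Parameters at which the segment from `z` to the barycenter meets a face missing `z`. This set
  -- is closed and avoids `0`, so for small `t > 0` any face containing the point at `t` also
  -- contains `z`.
  let S : Set ℝ := ⋃ G ∈ {G | G ∈ Γ.faces ∧ z ∉ convexHull ℝ (G : Set E)},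
    {t : ℝ | AffineMap.lineMap z b t ∈ convexHull ℝ (G : Set E)}
  have hS : IsClosed S :=
    (Γ.finite_faces.subset fun _ h => h.1).isClosed_biUnion
      fun G _ => isClosed_preimage_convexHull_finset G z b
  have h0 : (0 : ℝ) ∈ Sᶜ := by
    simp only [S, Set.mem_compl_iff, Set.mem_iUnion, not_exists]
    rintro G ⟨-, hG⟩ h
    exact hG (by simpa using h)
  obtain ⟨ε, hε, hball⟩ := Metric.isOpen_iff.1 hS.isOpen_compl 0 h0
  set t := min (ε / 2) 1 with ht
  have ht0 : 0 < t := lt_min (half_pos hε) one_pos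
  have ht1 : t ≤ 1 := min_le_right _ _
  have htS : t ∉ S := hball (by
    rw [Metric.mem_ball, Real.dist_eq, sub_zero, abs_of_pos ht0]
    exact (min_le_left _ _).trans_lt (half_lt_self hε))
  have htΔ : AffineMap.lineMap z b t ∈ convexHull ℝ (Set.range p) :=
    (convex_convexHull ℝ _).lineMap_mem hz hbmem ⟨ht0.le, ht1⟩
  obtain ⟨G, hG, hGt⟩ := Γ.exists_face_of_mem htΔ
  refine ⟨G, hG, ?_, _, hGt, fun i => ?_⟩
  · by_contra hzG
    exact htS (Set.mem_biUnion (show G ∈ {G | G ∈ Γ.faces ∧ z ∉ convexHull ℝ (G : Set E)} from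
      ⟨hG, hzG⟩) hGt)
  · rw [AffineMap.apply_lineMap, AffineMap.lineMap_apply_ring]
    have h1 := (hp.exists_weights_of_mem hz).1 i
    have h2 := hbpos i
    have h3 : 0 ≤ (1 - t) * hp.baryCoord i z := mul_nonneg (by linarith) h1
    have h4 : 0 < t * hp.baryCoord i b := mul_pos ht0 h2
    linarith

theorem mem_of_mem_convexHull {v : E} (hv : {v} ∈ Γ.faces) {G : Finset E} (hG : G ∈ Γ.faces)
    (h : v ∈ convexHull ℝ (G : Set E)) : v ∈ G := by
  have h1 := Γ.inter_subset_convexHull hv hG ⟨subset_convexHull _ _ (by simp), h⟩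
  obtain ⟨w, hw⟩ := convexHull_nonempty_iff.1 ⟨v, h1⟩
  obtain rfl : w = v := by simpa using hw.1
  exact hw.2

theorem pair_mem_faces {G : Finset E} (hG : G ∈ Γ.faces) [DecidableEq E] {u v : E} (hu : u ∈ G)
    (hv : v ∈ G) : {u, v} ∈ Γ.faces :=
  Γ.down_closed hG (by simp [Finset.insert_subset_iff, hu, hv]) (by simp)

theorem singleton_mem_faces {G : Finset E} (hG : G ∈ Γ.faces) {u : E} (hu : u ∈ G) :
    {u} ∈ Γ.faces :=
  Γ.down_closed hG (by simpa using hu) (by simp)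

theorem pair_mem_internalEdges {G : Finset E} (hG : G ∈ Γ.faces) [DecidableEq E] {u v : E}
    (hu : u ∈ G) (hv : v ∈ G) (huv : u ≠ v)
    (h : ∀ i, hp.baryCoord i u ≠ 0 ∨ hp.baryCoord i v ≠ 0) : {u, v} ∈ Γ.internalEdges := by
  refine ⟨Γ.pair_mem_faces hG hu hv, Finset.card_pair huv, Set.eq_univ_of_forall fun i => ?_⟩
  rw [Γ.mem_carrier_iff hp (Γ.pair_mem_faces hG hu hv)]
  simpa using h i

/-- A vertex carried by a facet of the simplex has exactly one vanishing barycentric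
coordinate. -/
theorem exists_baryCoord_eq_zero_iff {v : E} (hd : 1 ≤ d) (hv : {v} ∈ Γ.faces)
    (hc : (Γ.carrier {v}).ncard = d - 1) : ∃ i, ∀ k, hp.baryCoord k v = 0 ↔ k = i := by
  have hcompl : ((Γ.carrier {v})ᶜ).ncard = 1 := by
    rw [Set.ncard_compl, hc, Nat.card_fin]
    omega
  obtain ⟨i, hi⟩ := Set.ncard_eq_one.1 hcompl
  refine ⟨i, fun k => ?_⟩
  have : k ∈ (Γ.carrier {v})ᶜ ↔ k = i := by rw [hi]; rfl
  rw [Set.mem_compl_iff, Γ.mem_carrier_iff hp hv] at this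
  simpa using this

include hp in
/-- A vertex carried by a facet of the simplex is incident to an edge carried by the simplex. -/
theorem mem_internalVertices_of_ncard {v : E} (hd : 2 ≤ d) (hv : {v} ∈ Γ.faces)
    (hc : (Γ.carrier {v}).ncard = d - 1) : v ∈ Γ.internalVertices := by
  classical
  obtain ⟨G, hG, hvG, y, hyG, hy⟩ := Γ.exists_face_carrier_eq_univ hp (by omega)
    (Γ.mem_convexHull_range hv (Finset.mem_singleton_self v))
  have hmem := Γ.mem_of_mem_convexHull hv hG hvG
  obtain ⟨i, hi'⟩ := Γ.exists_baryCoord_eq_zero_iff hp (by omega) hv hc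
  obtain ⟨w, hwG, hw⟩ := exists_pos_of_mem_convexHull (hp.baryCoord i) hyG 0 (hy i)
  refine ⟨{v, w}, Γ.pair_mem_internalEdges hp hG hmem hwG ?_ fun k => ?_, by simp⟩
  · rintro rfl
    exact hw.ne' ((hi' i).2 rfl)
  · by_cases hk : k = i
    · exact Or.inr (hk ▸ hw.ne')
    · exact Or.inl (mt (hi' k).1 hk)

/-! ### A component with only facet vertices contains a triangle. -/

section TriangleFree

variable {S : Set E} {i j : Fin d}

/-- If a set `S` of vertices is closed under adjacency by edges carried by the simplex, spans no
triangle of such edges and all its members are carried by facets, then a face that contains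
members of `S` carried by two different facets has each vertex either in the intersection of these
facets, or in `S` and in the relative interior of one of the two. -/
theorem baryCoord_of_mem_face (hij : i ≠ j)
    (hclosed : ∀ u ∈ S, ∀ e ∈ Γ.internalEdges, u ∈ e → ∀ x ∈ e, x ∈ S)
    (htri : ∀ u ∈ S, ∀ v ∈ S, ∀ w ∈ S, ∀ e ∈ Γ.internalEdges, ∀ f ∈ Γ.internalEdges,
      ∀ g ∈ Γ.internalEdges, u ≠ v → u ≠ w → v ≠ w → u ∈ e → v ∈ e → u ∈ f → w ∈ f → v ∈ g →
      w ∈ g → False)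
    (hfacet : ∀ u ∈ S, ∃ i, ∀ k, hp.baryCoord k u = 0 ↔ k = i)
    {G : Finset E} (hG : G ∈ Γ.faces) {u w x : E} (hu : u ∈ G) (hw : w ∈ G) (hx : x ∈ G)
    (huS : u ∈ S) (hwS : w ∈ S) (hui : ∀ k, hp.baryCoord k u = 0 ↔ k = i)
    (hwj : ∀ k, hp.baryCoord k w = 0 ↔ k = j) :
    (hp.baryCoord i x ≠ 0 → x ∈ S ∧ ∀ k, hp.baryCoord k x = 0 ↔ k = j) := by
  classical
  intro hxi
  have hux : u ≠ x := fun h => hxi (h ▸ (hui i).2 rfl)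
  have huw : u ≠ w := fun h => hij ((hwj i).1 (h ▸ (hui i).2 rfl))
  have e1 : {u, x} ∈ Γ.internalEdges := Γ.pair_mem_internalEdges hp hG hu hx hux fun k => by
    by_cases hk : k = i
    · exact Or.inr (hk ▸ hxi)
    · exact Or.inl (mt (hui k).1 hk)
  have hxS : x ∈ S := hclosed u huS _ e1 (by simp) x (by simp)
  refine ⟨hxS, ?_⟩
  obtain ⟨l, hl⟩ := hfacet x hxS
  suffices hxj : hp.baryCoord j x = 0 by rwa [(hl j).1 hxj]
  -- Otherwise `u`, `w`, `x` would be pairwise joined by internal edges.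
  by_contra hxj
  have hwx : w ≠ x := fun h => hxj (h ▸ (hwj j).2 rfl)
  have e2 : {w, x} ∈ Γ.internalEdges := Γ.pair_mem_internalEdges hp hG hw hx hwx fun k => by
    by_cases hk : k = j
    · exact Or.inr (hk ▸ hxj)
    · exact Or.inl (mt (hwj k).1 hk)
  have e3 : {u, w} ∈ Γ.internalEdges := Γ.pair_mem_internalEdges hp hG hu hw huw fun k => by
    by_cases hk : k = i
    · exact Or.inr (mt (hwj k).1 (hk ▸ hij))
    · exact Or.inl (mt (hui k).1 hk)
  exact htri u huS w hwS x hxS _ e3 _ e1 _ e2 huw hux hwx (by simp) (by simp) (by simp) (by simp)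
    (by simp) (by simp)

/-- A nonempty set of vertices closed under adjacency by edges carried by the simplex and having
only members carried by facets spans a triangle of such edges. -/
theorem not_triangleFree (hd : 3 ≤ d)
    (hclosed : ∀ u ∈ S, ∀ e ∈ Γ.internalEdges, u ∈ e → ∀ x ∈ e, x ∈ S)
    (htri : ∀ u ∈ S, ∀ v ∈ S, ∀ w ∈ S, ∀ e ∈ Γ.internalEdges, ∀ f ∈ Γ.internalEdges,
      ∀ g ∈ Γ.internalEdges, u ≠ v → u ≠ w → v ≠ w → u ∈ e → v ∈ e → u ∈ f → w ∈ f → v ∈ g →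
      w ∈ g → False)
    (hfacet : ∀ u ∈ S, ∃ i, ∀ k, hp.baryCoord k u = 0 ↔ k = i)
    {e : Finset E} (he : e ∈ Γ.internalEdges) {a : E} (ha : a ∈ e) (haS : a ∈ S) : False := by
  classical
  obtain ⟨i, hai⟩ := hfacet a haS
  have hie : i ∈ Γ.carrier e := he.2.2 ▸ Set.mem_univ i
  obtain ⟨b, hb, hbi⟩ := (Γ.mem_carrier_iff hp he.1).1 hie
  have hbS : b ∈ S := hclosed a haS e he ha b hb
  obtain ⟨j, hbj⟩ := hfacet b hbS
  have hij : i ≠ j := mt (hbj i).2 hbi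
  -- The property to be propagated: `G` has vertices in `S` of both types `i` and `j`.
  let T : Finset E → Prop := fun G => ∃ u ∈ G, ∃ w ∈ G, u ∈ S ∧ w ∈ S ∧
    (∀ k, hp.baryCoord k u = 0 ↔ k = i) ∧ (∀ k, hp.baryCoord k w = 0 ↔ k = j)
  have hTi : ∀ G ∈ Γ.faces, T G → ∀ x ∈ G, hp.baryCoord i x ≠ 0 →
      x ∈ S ∧ ∀ k, hp.baryCoord k x = 0 ↔ k = j := by
    rintro G hG ⟨u, hu, w, hw, huS, hwS, hui, hwj⟩ x hx
    exact Γ.baryCoord_of_mem_face hp hij hclosed htri hfacet hG hu hw hx huS hwS hui hwj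
  have hTj : ∀ G ∈ Γ.faces, T G → ∀ x ∈ G, hp.baryCoord j x ≠ 0 →
      x ∈ S ∧ ∀ k, hp.baryCoord k x = 0 ↔ k = i := by
    rintro G hG ⟨u, hu, w, hw, huS, hwS, hui, hwj⟩ x hx
    exact Γ.baryCoord_of_mem_face hp hij.symm hclosed htri hfacet hG hw hu hx hwS huS hwj hui
  have hTmeet : ∀ G ∈ Γ.faces, ∀ H ∈ Γ.faces, T G → ∀ z ∈ convexHull ℝ (G : Set E),
      z ∈ convexHull ℝ (H : Set E) → (∀ k, 0 < hp.baryCoord k z) → T H := by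
    intro G hG H hH hT z hzG hzH hz
    -- The point `z` lies in the hull of the common vertices, so some common vertex is off facet `i`
    -- and another is off facet `j`; their types are known from `G`.
    have hzGH := Γ.inter_subset_convexHull hG hH ⟨hzG, hzH⟩
    obtain ⟨x, hx, hxi⟩ := exists_pos_of_mem_convexHull (hp.baryCoord i) hzGH 0 (hz i)
    obtain ⟨y, hy, hyj⟩ := exists_pos_of_mem_convexHull (hp.baryCoord j) hzGH 0 (hz j)
    obtain ⟨hxS, hxj⟩ := hTi G hG hT x hx.1 hxi.ne'
    obtain ⟨hyS, hyi⟩ := hTj G hG hT y hy.1 hyj.ne'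
    exact ⟨y, hy.2, x, hx.2, hyS, hxS, hyi, hxj⟩
  have hpi : p i ∈ convexHull ℝ (Set.range p) := subset_convexHull _ _ ⟨i, rfl⟩
  obtain ⟨H, hH, hpH, y, hyH, hy⟩ := Γ.exists_face_carrier_eq_univ hp (by omega) hpi
  have hTH : ¬ T H := by
    intro hT
    -- A third index, which exists because `d ≥ 3`. Some vertex of `H` has `i`-th coordinate at
    -- least `1`, hence `k`-th coordinate `0`, although its type is `j ≠ k`.
    obtain ⟨k, hk⟩ : ∃ k : Fin d, k ∉ ({i, j} : Finset (Fin d)) := by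
      by_contra! h
      have h1 := Finset.card_le_card (fun k _ => h k : Finset.univ ⊆ ({i, j} : Finset (Fin d)))
      have h2 := Finset.card_le_two (a := i) (b := j)
      simp only [Finset.card_univ, Fintype.card_fin] at h1
      omega
    simp only [Finset.mem_insert, Finset.mem_singleton, not_or] at hk
    have hle : ∀ g ∈ H, hp.baryCoord i g ≤ 1 - hp.baryCoord k g := by
      intro g hg
      obtain ⟨g0, g1, -⟩ := hp.exists_weights_of_mem (Γ.mem_convexHull_range hH hg)
      have := Finset.sum_le_sum_of_subset_of_nonneg (Finset.subset_univ ({i, k} : Finset (Fin d)))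
        (fun l _ _ => g0 l)
      rw [g1, Finset.sum_pair (Ne.symm hk.1)] at this
      linarith
    obtain ⟨g, hg, hgi⟩ := exists_le_of_mem_convexHull (hp.baryCoord i) hpH 1
      (by simp [hp.baryCoord_apply])
    have hgj := (hTi H hH hT g hg (by linarith)).2
    refine hk.2 ((hgj k).1 (le_antisymm ?_ (Γ.baryCoord_nonneg hp hH hg k)))
    linarith [hle g hg]
  have hTe : T e := ⟨a, ha, b, hb, haS, hbS, hai, hbj⟩
  have hx : midpoint ℝ a b ∈ convexHull ℝ (e : Set E) :=
    (convex_convexHull ℝ _).midpoint_mem (subset_convexHull _ _ ha) (subset_convexHull _ _ hb)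
  have hxpos : ∀ k, 0 < hp.baryCoord k (midpoint ℝ a b) := by
    intro k
    rw [AffineMap.map_midpoint, midpoint_eq_smul_add, smul_eq_mul]
    have ha0 := Γ.baryCoord_nonneg hp he.1 ha k
    have hb0 := Γ.baryCoord_nonneg hp he.1 hb k
    have : 0 < hp.baryCoord k a + hp.baryCoord k b := by
      by_cases hk : k = i
      · subst hk
        exact add_pos_of_nonneg_of_pos ha0 (lt_of_le_of_ne hb0 (Ne.symm hbi))
      · exact add_pos_of_pos_of_nonneg (lt_of_le_of_ne ha0 (Ne.symm (mt (hai k).1 hk))) hb0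
    simpa using this
  set x := midpoint ℝ a b
  -- The segment from `x` to `y` stays in the interior. The faces with and without `T` cover it by
  -- two closed sets, which meet by connectedness, contradicting `hTmeet`.
  let A : Set ℝ := ⋃ G ∈ {G | G ∈ Γ.faces ∧ T G},
    {t : ℝ | AffineMap.lineMap x y t ∈ convexHull ℝ (G : Set E)}
  let B : Set ℝ := ⋃ G ∈ {G | G ∈ Γ.faces ∧ ¬ T G},
    {t : ℝ | AffineMap.lineMap x y t ∈ convexHull ℝ (G : Set E)}
  have hA : IsClosed A := (Γ.finite_faces.subset fun _ h => h.1).isClosed_biUnion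
    fun G _ => isClosed_preimage_convexHull_finset G x y
  have hB : IsClosed B := (Γ.finite_faces.subset fun _ h => h.1).isClosed_biUnion
    fun G _ => isClosed_preimage_convexHull_finset G x y
  have memA : ∀ t, t ∈ A ↔ ∃ G ∈ Γ.faces, T G ∧
      AffineMap.lineMap x y t ∈ convexHull ℝ (G : Set E) := by
    intro t; simp [A, and_assoc]
  have memB : ∀ t, t ∈ B ↔ ∃ G ∈ Γ.faces, ¬ T G ∧
      AffineMap.lineMap x y t ∈ convexHull ℝ (G : Set E) := by
    intro t; simp [B, and_assoc]
  obtain ⟨t, ht, htA, htB⟩ := isPreconnected_closed_iff.1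
    (isPreconnected_Icc : IsPreconnected (Set.Icc (0 : ℝ) 1)) A B hA hB
    (fun t ht => by
      obtain ⟨G, hG, htG⟩ := Γ.exists_face_of_mem ((convex_convexHull ℝ _).lineMap_mem
        (Γ.convexHull_subset he.1 hx) (Γ.convexHull_subset hH hyH) ht)
      by_cases hT : T G
      · exact Or.inl ((memA t).2 ⟨G, hG, hT, htG⟩)
      · exact Or.inr ((memB t).2 ⟨G, hG, hT, htG⟩))
    ⟨0, by simp, (memA 0).2 ⟨e, he.1, hTe, by simpa using hx⟩⟩
    ⟨1, by simp, (memB 1).2 ⟨H, hH, hTH, by simpa using hyH⟩⟩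
  obtain ⟨G, hG, hTG, htG⟩ := (memA t).1 htA
  obtain ⟨G', hG', hTG', htG'⟩ := (memB t).1 htB
  refine hTG' (hTmeet G hG G' hG' hTG _ htG htG' fun k => ?_)
  rw [AffineMap.apply_lineMap]
  exact (convex_Ioi (0 : ℝ)).lineMap_mem (hxpos k) (hy k) ht

end TriangleFree

end SimplexTriangulation

/-! ### Expansion of the local `h`-polynomial over faces; its coefficients in degrees 1 and 2. -/

namespace SimplexTriangulation

variable {E : Type*} [AddCommGroup E] [Module ℝ E] {d : ℕ} {p : Fin d → E}
  (hp : AffineIndependent ℝ p) (Γ : SimplexTriangulation p)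

open Classical in
/-- The faces of the triangulation, including the empty one. -/
noncomputable def allFaces : Finset (Finset E) :=
  insert ∅ Γ.finite_faces.toFinset

theorem mem_allFaces {G : Finset E} : G ∈ Γ.allFaces ↔ G = ∅ ∨ G ∈ Γ.faces := by
  simp [allFaces]

include hp in
theorem card_le_ncard_carrier' {G : Finset E} (hG : G ∈ Γ.allFaces) :
    G.card ≤ (Γ.carrier G).ncard := by
  rcases Γ.mem_allFaces.1 hG with rfl | hG
  · simp
  · exact Γ.card_le_ncard_carrier hp hG

open Classical in
include hp in
theorem faceNumber_restrict (F : Finset (Fin d)) (k : ℕ) :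
    faceNumber (Γ.restrict F) k =
      (Γ.allFaces.filter fun G => Γ.carrier G ⊆ F ∧ G.card = k).card := by
  unfold faceNumber
  split_ifs with hk
  · subst hk
    symm
    rw [Finset.card_eq_one]
    refine ⟨∅, ?_⟩
    ext G
    simp only [Finset.mem_filter, Finset.card_eq_zero, Finset.mem_singleton]
    constructor
    · rintro ⟨-, -, h⟩; exact h
    · rintro rfl
      exact ⟨Γ.mem_allFaces.2 (Or.inl rfl), by simp [Γ.carrier_empty], rfl⟩
  · rw [← Set.ncard_coe_finset]
    congr 1
    ext G
    simp only [restrict, Set.mem_ofPred_eq, Finset.coe_filter, Γ.mem_allFaces]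
    constructor
    · rintro ⟨⟨hG, hGF⟩, hc⟩
      exact ⟨Or.inr hG, (Γ.subset_convexHull_image_iff_carrier hp hG).1 hGF, hc⟩
    · rintro ⟨rfl | hG, hGF, hc⟩
      · exact absurd hc.symm hk
      · exact ⟨⟨hG, (Γ.subset_convexHull_image_iff_carrier hp hG).2 hGF⟩, hc⟩

open Classical in
include hp in
theorem hPolynomial_restrict (F : Finset (Fin d)) :
    hPolynomial (Γ.restrict F) F.card =
      ∑ G ∈ Γ.allFaces with Γ.carrier G ⊆ F,
        (X : ℤ[X]) ^ G.card * (1 - X) ^ (F.card - G.card) := by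
  unfold hPolynomial
  -- Faces of `Γ_F` have at most `F.card` vertices, so grouping by cardinality loses none.
  have hmap : ∀ G ∈ Γ.allFaces.filter (fun G => Γ.carrier G ⊆ F),
      G.card ∈ Finset.range (F.card + 1) := by
    intro G hG
    rw [Finset.mem_filter] at hG
    have h1 := Γ.card_le_ncard_carrier' hp hG.1
    have h2 := Set.ncard_le_ncard hG.2 (Finset.finite_toSet F)
    rw [Set.ncard_coe_finset] at h2
    rw [Finset.mem_range]
    omega
  rw [← Finset.sum_fiberwise_of_maps_to hmap]
  refine Finset.sum_congr rfl fun k _ => ?_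
  rw [Γ.faceNumber_restrict hp, Finset.filter_filter,
    Finset.sum_congr rfl (g := fun _ => (X : ℤ[X]) ^ k * (1 - X) ^ (F.card - k))]
  · rw [Finset.sum_const, nsmul_eq_mul, mul_assoc]
  · intro G hG
    rw [(Finset.mem_filter.1 hG).2.2]

/-- Writing `F = A ∪ B` with `B` in the complement of `A`, this is the binomial theorem for `(1 - X)
+ (-1) = -X`. -/
theorem sum_superset_alternating {n : ℕ} (A : Finset (Fin n)) (k : ℕ) (hk : k ≤ A.card) :
    ∑ F : Finset (Fin n) with A ⊆ F,
      (-1 : ℤ[X]) ^ (n - F.card) * (1 - X) ^ (F.card - k) =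
      (1 - X) ^ (A.card - k) * (-X) ^ (n - A.card) := by
  have hA : A.card ≤ n := by simpa using A.card_le_univ
  have hcompl : Aᶜ.card = n - A.card := by simp [Finset.card_compl]
  have h := Finset.sum_pow_mul_eq_add_pow (1 - X : ℤ[X]) (-1) Aᶜ
  rw [hcompl, show (1 - X + -1 : ℤ[X]) = -X by ring] at h
  rw [← h, Finset.mul_sum]
  symm
  refine Finset.sum_bij' (fun B _ => A ∪ B) (fun F _ => F \ A) ?_ ?_ ?_ ?_ ?_
  · intro B _; simp
  · intro F _
    simp only [Finset.mem_powerset]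
    intro x hx
    simp only [Finset.mem_sdiff] at hx
    simpa using hx.2
  · intro B hB
    rw [Finset.mem_powerset] at hB
    ext x
    have := @hB x
    simp only [Finset.mem_compl] at this
    simp only [Finset.mem_sdiff, Finset.mem_union]
    tauto
  · intro F hF
    exact Finset.union_sdiff_of_subset (by simpa using hF)
  · intro B hB
    rw [Finset.mem_powerset] at hB
    have hdisj : Disjoint A B := Finset.disjoint_left.2 fun x hx hxB => by simpa [hx] using hB hxB
    have hBc := Finset.card_le_card hB
    rw [hcompl] at hBc
    rw [Finset.card_union_of_disjoint hdisj, show A.card + B.card - k = A.card - k + B.card by omega,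
      pow_add, Nat.sub_sub]
    ring

open Classical in
include hp in
theorem localH_eq_sum :
    Γ.localH = ∑ G ∈ Γ.allFaces, (-1 : ℤ[X]) ^ (d - (Γ.carrier G).ncard) *
      X ^ (d - (Γ.carrier G).ncard + G.card) * (1 - X) ^ ((Γ.carrier G).ncard - G.card) := by
  unfold localH
  simp_rw [Γ.hPolynomial_restrict hp, Finset.mul_sum, Finset.sum_filter]
  rw [Finset.sum_comm]
  refine Finset.sum_congr rfl fun G hG => ?_
  obtain ⟨A, hA⟩ : ∃ A : Finset (Fin d), (A : Set (Fin d)) = Γ.carrier G :=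
    ⟨_, (Set.toFinite (Γ.carrier G)).coe_toFinset⟩
  have hk := Γ.card_le_ncard_carrier' hp hG
  rw [← hA, Set.ncard_coe_finset] at *
  have h := sum_superset_alternating A G.card hk
  rw [Finset.sum_filter] at h
  rw [neg_pow (X : ℤ[X])] at h
  rw [show (-1 : ℤ[X]) ^ (d - A.card) * X ^ (d - A.card + G.card) * (1 - X) ^ (A.card - G.card)
    = X ^ G.card * ((1 - X) ^ (A.card - G.card) * ((-1) ^ (d - A.card) * X ^ (d - A.card))) by
      ring, ← h, Finset.mul_sum]
  refine Finset.sum_congr rfl fun F _ => ?_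
  simp only [Finset.coe_subset]
  split_ifs
  · ring
  · simp

theorem coeff_one_sign_mul_X_pow (a m n : ℕ) (hm : 1 ≤ m) :
    ((-1 : ℤ[X]) ^ a * X ^ m * (1 - X) ^ n).coeff 1 = if m = 1 then (-1) ^ a else 0 := by
  obtain ⟨m, rfl⟩ := Nat.exists_eq_add_of_le hm
  rw [show (-1 : ℤ[X]) ^ a * X ^ (1 + m) * (1 - X) ^ n
    = (C ((-1) ^ a) * (X ^ m * (1 - X) ^ n)) * X by simp; ring, coeff_mul_X, coeff_C_mul,
    coeff_zero_eq_eval_zero]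
  rcases Nat.eq_zero_or_pos m with rfl | h
  · simp
  · simp [h.ne']

theorem coeff_two_sign_mul_X_pow (a m n : ℕ) (hm : 2 ≤ m) :
    ((-1 : ℤ[X]) ^ a * X ^ m * (1 - X) ^ n).coeff 2 = if m = 2 then (-1) ^ a else 0 := by
  obtain ⟨m, rfl⟩ := Nat.exists_eq_add_of_le hm
  rw [show (-1 : ℤ[X]) ^ a * X ^ (2 + m) * (1 - X) ^ n
    = (C ((-1) ^ a) * (X ^ m * (1 - X) ^ n)) * X ^ 2 by simp; ring, coeff_mul_X_pow', if_pos le_rfl,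
    coeff_C_mul, Nat.sub_self, coeff_zero_eq_eval_zero]
  rcases Nat.eq_zero_or_pos m with rfl | h
  · simp
  · simp [h.ne']

include hp in
-- Bounds that determine which faces reach a low exponent `d - c + |G|`; the empty face has exponent
-- `d`.
theorem one_le_card_of_mem_allFaces {G : Finset E} (hG : G ∈ Γ.allFaces) :
    (G.card = 0 ∧ (Γ.carrier G).ncard = 0) ∨
      (1 ≤ G.card ∧ G.card ≤ (Γ.carrier G).ncard ∧ (Γ.carrier G).ncard ≤ d) := by
  have h3 : (Γ.carrier G).ncard ≤ d := by
    simpa [Nat.card_fin] using Set.ncard_le_ncard (Set.subset_univ (Γ.carrier G))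
  rcases Γ.mem_allFaces.1 hG with rfl | h
  · simp [Γ.carrier_empty]
  · exact Or.inr ⟨(Γ.nonempty_of_mem_faces h).card_pos, Γ.card_le_ncard_carrier hp h, h3⟩

open Classical in
include hp in
theorem localH_coeff_one (hd : 3 ≤ d) : Γ.localH.coeff 1 =
    (Γ.allFaces.filter fun G => G.card = 1 ∧ (Γ.carrier G).ncard = d).card := by
  rw [Γ.localH_eq_sum hp, finsetSum_coeff, Finset.card_filter, Nat.cast_sum]
  refine Finset.sum_congr rfl fun G hG => ?_
  have hG' := Γ.one_le_card_of_mem_allFaces hp hG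
  rw [coeff_one_sign_mul_X_pow _ _ _ (by omega)]
  by_cases h : G.card = 1 ∧ (Γ.carrier G).ncard = d
  · simp [h.1, h.2]
  · rw [if_neg (by omega), if_neg h, Nat.cast_zero]

open Classical in
include hp in
theorem localH_coeff_two (hd : 3 ≤ d) (hℓ : Γ.localH.coeff 1 = 0) : Γ.localH.coeff 2 =
    (Γ.allFaces.filter fun G => G.card = 2 ∧ (Γ.carrier G).ncard = d).card -
    (Γ.allFaces.filter fun G => G.card = 1 ∧ (Γ.carrier G).ncard = d - 1).card := by
  -- With no vertex carried by `Δ`, every exponent is at least 2. Equality holds for edges carried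
  -- by `Δ`, with sign `+`, and vertices carried by facets, with sign `-`.
  rw [Γ.localH_coeff_one hp hd, Nat.cast_eq_zero, Finset.card_eq_zero,
    Finset.filter_eq_empty_iff] at hℓ
  rw [Γ.localH_eq_sum hp, finsetSum_coeff, Finset.card_filter, Finset.card_filter, Nat.cast_sum,
    Nat.cast_sum, ← Finset.sum_sub_distrib]
  refine Finset.sum_congr rfl fun G hG => ?_
  have hG' := Γ.one_le_card_of_mem_allFaces hp hG
  have hG1 := hℓ hG
  rw [coeff_two_sign_mul_X_pow _ _ _ (by omega)]
  by_cases h : G.card = 2 ∧ (Γ.carrier G).ncard = d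
  · simp [h.1, h.2]
  by_cases h1 : G.card = 1 ∧ (Γ.carrier G).ncard = d - 1
  · have : d - (d - 1) = 1 := by omega
    simp [h1.1, h1.2, this]
  · rw [if_neg (by omega), if_neg h, if_neg h1]
    simp

end SimplexTriangulation

/-! ### Counting vertices and edges in components of the internal edge graph. -/

namespace SimplexTriangulation

variable {E : Type*} [AddCommGroup E] [Module ℝ E] {d : ℕ} {p : Fin d → E}
  (hp : AffineIndependent ℝ p) (Γ : SimplexTriangulation p)

theorem finite_internalEdges : Γ.internalEdges.Finite :=
  Γ.finite_faces.subset fun _ h => h.1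

instance finite_internalVertices : Finite Γ.internalVertices := by
  refine Set.Finite.subset (Γ.finite_internalEdges.biUnion fun e _ => e.finite_toSet) ?_
  rintro v ⟨e, he, hv⟩
  exact Set.mem_biUnion he hv

theorem singleton_mem_faces_of_internalVertices (v : Γ.internalVertices) :
    {(v : E)} ∈ Γ.faces := by
  obtain ⟨v, e, he, hv⟩ := v
  exact Γ.singleton_mem_faces he.1 hv

theorem coe_eq_pair_of_internalEdges {e : Finset E} (he : e ∈ Γ.internalEdges) {u v : E}
    (hu : u ∈ e) (hv : v ∈ e) (huv : u ≠ v) : (e : Set E) = {u, v} := by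
  classical
  have h : ({u, v} : Finset E) = e := by
    refine Finset.eq_of_subset_of_card_le (by simp [Finset.insert_subset_iff, hu, hv]) ?_
    rw [Finset.card_pair huv, he.2.1]
  simp [← h]

theorem internalEdgeGraph_adj {e : Finset E} (he : e ∈ Γ.internalEdges) {u v : Γ.internalVertices}
    (hu : (u : E) ∈ e) (hv : (v : E) ∈ e) (huv : u ≠ v) : Γ.internalEdgeGraph.Adj u v :=
  ⟨huv, e, he, Γ.coe_eq_pair_of_internalEdges he hu hv (Subtype.coe_injective.ne huv)⟩

theorem exists_ne_of_mem_internalEdges {e : Finset E} (he : e ∈ Γ.internalEdges) (u : E) :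
    ∃ v ∈ e, v ≠ u :=
  Finset.exists_mem_ne (by rw [he.2.1]; norm_num) u

/-- The edges of a connected component of the internal edge graph. -/
def componentEdges (C : Γ.internalEdgeGraph.ConnectedComponent) : Set (Finset E) :=
  {e | e ∈ Γ.internalEdges ∧ ∃ v ∈ C.supp, (v : E) ∈ e}

theorem finite_componentEdges (C : Γ.internalEdgeGraph.ConnectedComponent) :
    (Γ.componentEdges C).Finite :=
  Γ.finite_internalEdges.subset fun _ h => h.1

theorem mem_supp_of_mem_componentEdges {C : Γ.internalEdgeGraph.ConnectedComponent}
    {e : Finset E} (he : e ∈ Γ.componentEdges C) {u : Γ.internalVertices} (hu : (u : E) ∈ e) :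
    u ∈ C.supp := by
  obtain ⟨he, v, hv, hve⟩ := he
  by_cases huv : v = u
  · exact huv ▸ hv
  · exact C.mem_supp_of_adj_mem_supp hv (Γ.internalEdgeGraph_adj he hve hu huv)

theorem componentFaceNumber_one (hd : 1 ≤ d) (C : Γ.internalEdgeGraph.ConnectedComponent) :
    Γ.componentFaceNumber C 1 (d - 1) = (Γ.componentEdges C).ncard := by
  unfold componentFaceNumber
  congr 1
  ext G
  constructor
  · rintro ⟨⟨v, -, rfl⟩ | ⟨u, hu, v, -, ⟨-, e, he, heq⟩, hG⟩, hc, -⟩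
    · simp at hc
    · obtain rfl : G = e := Finset.coe_injective (hG.trans heq.symm)
      exact ⟨he, u, hu, by rw [← Finset.mem_coe, hG]; simp⟩
  · intro hG
    obtain ⟨he, u, hu, hue⟩ := id hG
    obtain ⟨v, hv, hne⟩ := Γ.exists_ne_of_mem_internalEdges he u
    let v' : Γ.internalVertices := ⟨v, G, he, hv⟩
    have huv : u ≠ v' := fun h => hne (congrArg Subtype.val h).symm
    refine ⟨Or.inr ⟨u, hu, v', Γ.mem_supp_of_mem_componentEdges hG hv,
      Γ.internalEdgeGraph_adj he hue hv huv, Γ.coe_eq_pair_of_internalEdges he hue hv hne.symm⟩,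
      he.2.1, ?_⟩
    rw [he.2.2, Set.ncard_univ, Nat.card_fin]
    omega

/-- Passes to the edge set of an abstract graph, where edge counts of connected graphs and trees
apply. -/
theorem ncard_componentEdges (C : Γ.internalEdgeGraph.ConnectedComponent) :
    (Γ.componentEdges C).ncard = Nat.card C.toSimpleGraph.edgeSet := by
  classical
  rw [Nat.card_coe_set_eq]
  let φ : C → E := fun v => (v.1 : E)
  have hφ : Function.Injective φ := Subtype.coe_injective.comp Subtype.coe_injective
  have hinj : Function.Injective fun s : Sym2 C => (s.map φ).toFinset := by
    intro s t h
    refine Sym2.map.injective hφ (Sym2.ext fun x => ?_)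
    rw [← Sym2.mem_toFinset, ← Sym2.mem_toFinset]
    exact iff_of_eq (congrArg (x ∈ ·) h)
  rw [← Set.ncard_image_of_injective _ hinj]
  congr 1
  ext e
  constructor
  · intro he
    obtain ⟨hi, u, hu, hue⟩ := id he
    obtain ⟨v, hv, hne⟩ := Γ.exists_ne_of_mem_internalEdges hi u
    let v' : Γ.internalVertices := ⟨v, e, hi, hv⟩
    have huv : u ≠ v' := fun h => hne (congrArg Subtype.val h).symm
    refine ⟨s(⟨u, hu⟩, ⟨v', Γ.mem_supp_of_mem_componentEdges he hv⟩),
      Γ.internalEdgeGraph_adj hi hue hv huv, ?_⟩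
    refine Finset.coe_injective ?_
    simp only [Sym2.map_mk, Sym2.toFinset_mk_eq]
    rw [Γ.coe_eq_pair_of_internalEdges hi hue hv hne.symm]
    simp [φ, v']
  · rintro ⟨s, hs, rfl⟩
    induction s using Sym2.ind with
    | _ u v =>
      obtain ⟨-, e, he, heq⟩ : Γ.internalEdgeGraph.Adj u.1 v.1 := hs
      have : (s(u, v).map φ).toFinset = e := by
        refine Finset.coe_injective ?_
        rw [heq]
        simp [φ, Sym2.toFinset_mk_eq]
      change (s(u, v).map φ).toFinset ∈ _
      rw [this]
      exact ⟨he, u.1, u.2, by rw [← Finset.mem_coe, heq]; simp⟩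

theorem componentFaceNumber_zero (hd : 2 ≤ d) (C : Γ.internalEdgeGraph.ConnectedComponent) :
    Γ.componentFaceNumber C 0 (d - 2) =
      {v : Γ.internalVertices | v ∈ C.supp ∧ (Γ.carrier {(v : E)}).ncard = d - 1}.ncard := by
  have hinj : Function.Injective fun v : Γ.internalVertices => ({(v : E)} : Finset E) :=
    Finset.singleton_injective.comp Subtype.coe_injective
  rw [← Set.ncard_image_of_injective _ hinj]
  unfold componentFaceNumber
  congr 1
  ext G
  constructor
  · rintro ⟨⟨v, hv, rfl⟩ | ⟨u, -, v, -, ⟨-, e, he, heq⟩, hG⟩, hc, hn⟩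
    · exact ⟨v, ⟨hv, by omega⟩, rfl⟩
    · obtain rfl : G = e := Finset.coe_injective (hG.trans heq.symm)
      have := he.2.1
      omega
  · rintro ⟨v, ⟨hv, hn⟩, rfl⟩
    exact ⟨Or.inl ⟨v, hv, rfl⟩, by simp, by simp only [hn]; omega⟩

theorem sum_componentFaceNumber_one (hd : 1 ≤ d) :
    ∑ᶠ C, Γ.componentFaceNumber C 1 (d - 1) = Γ.internalEdges.ncard := by
  simp_rw [Γ.componentFaceNumber_one hd]
  rw [← Set.ncard_iUnion_of_finite Γ.finite_componentEdges]
  · congr 1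
    ext e
    simp only [Set.mem_iUnion]
    refine ⟨fun ⟨C, h⟩ => h.1, fun he => ?_⟩
    obtain ⟨v, hv⟩ : e.Nonempty := Γ.nonempty_of_mem_faces he.1
    exact ⟨Γ.internalEdgeGraph.connectedComponentMk ⟨v, e, he, hv⟩, he, ⟨v, e, he, hv⟩, rfl, hv⟩
  · intro C D hCD
    refine Set.disjoint_left.2 fun e hC hD => hCD ?_
    obtain ⟨he, v, hv, hve⟩ := hC
    exact hv.symm.trans (Γ.mem_supp_of_mem_componentEdges hD hve)

theorem sum_componentFaceNumber_zero (hd : 2 ≤ d) :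
    ∑ᶠ C, Γ.componentFaceNumber C 0 (d - 2) =
      {v : Γ.internalVertices | (Γ.carrier {(v : E)}).ncard = d - 1}.ncard := by
  simp_rw [Γ.componentFaceNumber_zero hd]
  rw [← Set.ncard_iUnion_of_finite fun _ => Set.toFinite _]
  · congr 1
    ext v
    simp
  · intro C D hCD
    refine Set.disjoint_left.2 fun v hC hD => hCD ?_
    exact hC.1.symm.trans hD.1

include hp in
theorem localH_coeff_two_eq_sum (hd : 3 ≤ d) (hℓ : Γ.localH.coeff 1 = 0) :
    Γ.localH.coeff 2 = ∑ᶠ C : Γ.internalEdgeGraph.ConnectedComponent,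
      ((Γ.componentFaceNumber C 1 (d - 1) : ℤ) - (Γ.componentFaceNumber C 0 (d - 2) : ℤ)) := by
  classical
  rw [finsum_sub_distrib (Set.toFinite _) (Set.toFinite _), Γ.localH_coeff_two hp hd hℓ]
  have hcast : ∀ f : Γ.internalEdgeGraph.ConnectedComponent → ℕ,
      ∑ᶠ C, (f C : ℤ) = ((∑ᶠ C, f C : ℕ) : ℤ) := fun f =>
    ((Nat.castAddMonoidHom ℤ).map_finsum (Set.toFinite _)).symm
  rw [hcast, hcast, Γ.sum_componentFaceNumber_one (by omega),
    Γ.sum_componentFaceNumber_zero (by omega)]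
  congr 2
  · rw [← Set.ncard_coe_finset]
    congr 1
    ext G
    simp only [Finset.coe_filter, Set.mem_ofPred_eq, Γ.mem_allFaces, internalEdges]
    constructor
    · rintro ⟨rfl | hG, hc, hn⟩
      · simp at hc
      · refine ⟨hG, hc, Set.eq_of_subset_of_ncard_le (Set.subset_univ _) ?_⟩
        simp [hn]
    · rintro ⟨hG, hc, hn⟩
      exact ⟨Or.inr hG, hc, by simp [hn, Set.ncard_univ]⟩
  · have hinj : Function.Injective fun v : Γ.internalVertices => ({(v : E)} : Finset E) :=
      Finset.singleton_injective.comp Subtype.coe_injective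
    rw [← Set.ncard_coe_finset, ← Set.ncard_image_of_injective _ hinj]
    congr 1
    ext G
    simp only [Finset.coe_filter, Set.mem_ofPred_eq, Γ.mem_allFaces]
    constructor
    · rintro ⟨rfl | hG, hc, hn⟩
      · simp at hc
      · obtain ⟨v, rfl⟩ := Finset.card_eq_one.1 hc
        exact ⟨⟨v, Γ.mem_internalVertices_of_ncard hp (by omega) hG hn⟩, hn, rfl⟩
    · rintro ⟨v, hv, rfl⟩
      exact ⟨Or.inr (Γ.singleton_mem_faces_of_internalVertices v), by simp, hv⟩

include hp in
theorem componentFaceNumber_zero_le (hd : 3 ≤ d) (C : Γ.internalEdgeGraph.ConnectedComponent) :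
    Γ.componentFaceNumber C 0 (d - 2) ≤ Γ.componentFaceNumber C 1 (d - 1) := by
  classical
  rw [Γ.componentFaceNumber_zero (by omega), Γ.componentFaceNumber_one (by omega),
    Γ.ncard_componentEdges]
  by_contra! hlt
  have hconn := C.connected_toSimpleGraph
  have hle := hconn.card_vert_le_card_edgeSet_add_one
  have hcard : Nat.card C = C.supp.ncard := Nat.card_coe_set_eq C.supp
  have hsub : {v : Γ.internalVertices | v ∈ C.supp ∧ (Γ.carrier {(v : E)}).ncard = d - 1}
    ⊆ C.supp := fun v hv => hv.1
  have hsubc := Set.ncard_le_ncard hsub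
  -- More facet vertices than edges, and at least `|C| - 1` edges: all vertices must be facet
  -- vertices, and there are exactly `|C| - 1` edges.
  have hall : ∀ v ∈ C.supp, (Γ.carrier {(v : E)}).ncard = d - 1 := by
    have := Set.eq_of_subset_of_ncard_le hsub (by omega)
    intro v hv
    rw [← this] at hv
    exact hv.2
  have htree : C.toSimpleGraph.IsTree :=
    SimpleGraph.isTree_iff_connected_and_card.2 ⟨hconn, by omega⟩
  have hfree := htree.isAcyclic.cliqueFree le_rfl
  obtain ⟨v, hv⟩ := C.nonempty_supp
  obtain ⟨e, he, hve⟩ := v.2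
  refine Γ.not_triangleFree hp (S := Subtype.val '' C.supp) hd ?_ ?_ ?_ he hve ⟨v, hv, rfl⟩
  · rintro _ ⟨u, hu, rfl⟩ f hf huf x hx
    exact ⟨⟨x, f, hf, hx⟩, Γ.mem_supp_of_mem_componentEdges ⟨hf, u, hu, huf⟩ hx, rfl⟩
  · rintro _ ⟨u, hu, rfl⟩ _ ⟨v, hv, rfl⟩ _ ⟨w, hw, rfl⟩ e he f hf g hg huv huw hvw hue hve huf hwf
      hvg hwg
    refine hfree {⟨u, hu⟩, ⟨v, hv⟩, ⟨w, hw⟩} (SimpleGraph.is3Clique_triple_iff.2 ⟨?_, ?_, ?_⟩)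
    · exact Γ.internalEdgeGraph_adj he hue hve (ne_of_apply_ne _ huv)
    · exact Γ.internalEdgeGraph_adj hf huf hwf (ne_of_apply_ne _ huw)
    · exact Γ.internalEdgeGraph_adj hg hvg hwg (ne_of_apply_ne _ hvw)
  · rintro _ ⟨u, hu, rfl⟩
    exact Γ.exists_baryCoord_eq_zero_iff hp (by omega)
      (Γ.singleton_mem_faces_of_internalVertices u) (hall u hu)

end SimplexTriangulation

theorem mainTheorem5 {E : Type*} [AddCommGroup E] [Module ℝ E] {d : ℕ} (hd : 3 ≤ d)
    (p : Fin d → E) (hp : AffineIndependent ℝ p) (Γ : SimplexTriangulation p)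
    (hℓ : Γ.localH.coeff 1 = 0) :
    (∀ C : Γ.internalEdgeGraph.ConnectedComponent,
      Γ.componentFaceNumber C 0 (d - 2) ≤ Γ.componentFaceNumber C 1 (d - 1)) ∧
    Γ.localH.coeff 2 =
      ∑ᶠ C : Γ.internalEdgeGraph.ConnectedComponent,
        ((Γ.componentFaceNumber C 1 (d - 1) : ℤ) - (Γ.componentFaceNumber C 0 (d - 2) : ℤ)) ∧
    0 ≤ Γ.localH.coeff 2 := by
  have hle := Γ.componentFaceNumber_zero_le hp hd
  have hsum := Γ.localH_coeff_two_eq_sum hp hd hℓ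
  refine ⟨hle, hsum, ?_⟩
  rw [hsum]
  exact finsum_nonneg fun C => sub_nonneg.2 (by exact_mod_cast hle C)
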